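/- For a sequence $(c_k)_{k\ge 0}$ and an integer $n\ge 0$ let $H_n(c_k)=\det\,(c_{i+j})_{0\le i,j\le n}$ denote its Hankel determinant, and let $B_m(t)$ denote the $m$-th Bernoulli polynomial. Let $K$ be a field of characteristic zero (for instance $\mathbb{C}$, or the field $\mathbb{Q}(x)$ with $x$ an indeterminate). Then for every $x\in K$ and every integer $n\ge 0$, $$H_n\!\left(\frac{B_{2k+1}\left(\frac{x+1}{2}\right)}{2k+1}\right)=\left(\frac{x}{2}\right)^{n+1}\prod_{\ell=1}^{n}\left(\frac{(2\ell)^{2}(2\ell-1)^{2}\,(x^{2}-(2\ell-1)^{2})\,(x^{2}-(2\ell)^{2})}{16(4\ell-3)(4\ell-1)^{2}(4\ell+1)}\right)^{n+1-\ell}$$ and $$H_n\!\left(\frac{B_{2k+3}\left(\frac{x+1}{2}\right)}{2k+3}\right)=\left(\frac{x^{3}-x}{24}\right)^{n+1}\prod_{\ell=1}^{n}\left(\frac{(2\ell)^{2}(2\ell+1)^{2}\,(x^{2}-(2\ell+1)^{2})\,(x^{2}-(2\ell)^{2})}{16(4\ell-1)(4\ell+1)^{2}(4\ell+3)}\right)^{n+1-\ell}.$$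 -/

import Mathlib

open Polynomial

/-- The Hankel determinant `H_n(c)` of a sequence `c = (c₀, c₁, …)`: the determinant of the
`(n+1) × (n+1)` matrix `(c_{i+j})` with `0 ≤ i, j ≤ n`. -/
def hankelDet {R : Type*} [CommRing R] (n : ℕ) (c : ℕ → R) : R :=
  Matrix.det (Matrix.of fun i j : Fin (n + 1) => c ((i : ℕ) + (j : ℕ)))

/-!
The entries of both Hankel matrices are even moments of one functional `L` on `K[X]`, with
`L (X ^ (2 k)) = B_{2k+1}((x + 1) / 2) / (2 k + 1)` and vanishing odd moments (`halfSum`). When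
`x = 2 N`, it is half of the sum of the values at the `x` equally spaced points
`(1 - x) / 2, (3 - x) / 2, …, (x - 1) / 2`, so its orthogonal polynomials are the discrete Chebyshev
polynomials centred at the origin. They satisfy
`p (n + 2) = X p (n + 1) - β (n + 1) p n` with `β n = n² (x² - n²) / (4 (2 n - 1) (2 n + 1))`.

All of this persists for arbitrary `x` in a field of characteristic zero, because `L` is
characterized by `L (F (X + 1) - F) = (F b - F a) / 2` with `a = (1 - x) / 2` and
`b = (x + 1) / 2` (`halfSum_difference`, a form of the recursion of the Bernoulli polynomials).
In particular `L` has explicit values on the falling factorials of `X - a`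
(`halfSum_descPochhammer`). The solution of the recurrence has an explicit expansion in these
falling factorials (`chebPoly`, `centralBinom_smul_recurrencePoly`), and applying `L` to it gives
an alternating binomial sum that telescopes to zero, so `L (p n) = 0` for `n ≥ 1`
(`halfSum_recurrencePoly_chebBeta`). By Favard's principle
(`recurrencePoly_orthogonal`) this alone implies that the `p n` are orthogonal, with
`L (p n ^ 2) = L 1 * β 1 * ⋯ * β n`.

Finally `p (2 l) = P l (X ^ 2)` and `p (2 l + 1) = X * Q l (X ^ 2)` with monic `P l` and `Q l` of
degree `l`. These are orthogonal for the moment sequences `L (X ^ (2 k))` and `L (X ^ (2 k + 2))`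
respectively, so the Hankel determinants are the products of their squared norms
(`hankelDet_even_moments`), in which `β (2 l - 1) * β (2 l)` and `β (2 l) * β (2 l + 1)` give the
factors of the two formulas.
-/

/-! ### Hankel determinants and orthogonal polynomials -/

/-- The Hankel determinant of the moments is the product of the squared norms of the monic
orthogonal polynomials: passing from the monomials to another basis of monic polynomials
`P 0, …, P n` does not change the determinant of the Gram matrix. -/
theorem hankelDet_eq_prod_of_orthogonal {R : Type*} [CommRing R] [Nontrivial R]
    (M : R[X] →ₗ[R] R) (P : ℕ → R[X]) (h : ℕ → R)
    (hmonic : ∀ l, (P l).Monic) (hdeg : ∀ l, (P l).natDegree = l)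
    (horth : ∀ i j, M (P i * P j) = if i = j then h i else 0) (n : ℕ) :
    hankelDet n (fun k => M (X ^ k)) = ∏ l ∈ Finset.range (n + 1), h l := by
  set A : Matrix (Fin (n + 1)) (Fin (n + 1)) R := Matrix.of fun i j => (P j).coeff i with hA
  have hdetA : A.det = 1 :=
    Matrix.det_matrixOfPolynomials (fun j : Fin (n + 1) => P j) (fun j => hdeg j)
      (fun j => hmonic j)
  have hexp (i : Fin (n + 1)) : P i = ∑ k : Fin (n + 1), (P i).coeff k • X ^ (k : ℕ) := by
    rw [Fin.sum_univ_eq_sum_range (fun k => (P i).coeff k • (X : R[X]) ^ k)]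
    conv_lhs => rw [(P i).as_sum_range' (n + 1) (by rw [hdeg]; exact i.2)]
    simp [smul_X_eq_monomial]
  have hgram : A.transpose * (Matrix.of fun i j : Fin (n + 1) => M (X ^ ((i : ℕ) + (j : ℕ)))) * A
      = Matrix.diagonal fun i : Fin (n + 1) => h i := by
    ext i j
    have key : M (P i * P j) = if i = j then h i else 0 := by
      rw [horth]; simp [Fin.ext_iff]
    rw [Matrix.diagonal_apply, ← key, hexp i, hexp j, Finset.sum_mul_sum, Finset.sum_comm]
    simp only [Matrix.mul_apply, Matrix.transpose_apply, Matrix.of_apply, map_sum, hA,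
      smul_mul_smul_comm, map_smul, ← pow_add, smul_eq_mul, Finset.sum_mul]
    refine Finset.sum_congr rfl fun k _ => Finset.sum_congr rfl fun l _ => ?_
    ring
  have hdet := congrArg Matrix.det hgram
  rw [Matrix.det_mul, Matrix.det_mul, Matrix.det_transpose, hdetA, Matrix.det_diagonal,
    Fin.prod_univ_eq_prod_range] at hdet
  simpa [hankelDet] using hdet

/-- The monic polynomials with symmetric three-term recurrence
`p (n + 2) = X * p (n + 1) - β (n + 1) * p n`, started at `p 0 = 1` and `p 1 = X`.
The value `β 0` is not used. -/
noncomputable def recurrencePoly {R : Type*} [CommRing R] (β : ℕ → R) : ℕ → R[X]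
  | 0 => 1
  | 1 => X
  | n + 2 => X * recurrencePoly β (n + 1) - C (β (n + 1)) * recurrencePoly β n

/-- Favard's principle: a functional that kills every `p n` with `n ≥ 1` makes the whole family
orthogonal. Evaluating it on `X * p m * p n` in two ways determines all `L (p m * p n)` from the
row `m = 0`. -/
theorem recurrencePoly_orthogonal {R : Type*} [CommRing R] (β : ℕ → R) (L : R[X] →ₗ[R] R)
    (hL : ∀ n, L (recurrencePoly β (n + 1)) = 0) (m n : ℕ) :
    L (recurrencePoly β m * recurrencePoly β n) =
      if m = n then L 1 * ∏ i ∈ Finset.range n, β (i + 1) else 0 := by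
  have hmul (n : ℕ) : X * recurrencePoly β (n + 1) =
      recurrencePoly β (n + 2) + C (β (n + 1)) * recurrencePoly β n := by
    simp [recurrencePoly]
  have hC (c : R) (f : R[X]) : L (C c * f) = c * L f := by
    rw [← smul_eq_C_mul, map_smul, smul_eq_mul]
  have h0 (n : ℕ) : L (recurrencePoly β 0 * recurrencePoly β n) =
      if 0 = n then L 1 * ∏ i ∈ Finset.range n, β (i + 1) else 0 := by
    cases n with
    | zero => simp [recurrencePoly]
    | succ n => simp [recurrencePoly, hL]
  have h1 (n : ℕ) : L (recurrencePoly β 1 * recurrencePoly β n) =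
      if 1 = n then L 1 * ∏ i ∈ Finset.range n, β (i + 1) else 0 := by
    cases n with
    | zero => simpa [recurrencePoly] using hL 0
    | succ n =>
      have h : recurrencePoly β 1 * recurrencePoly β (n + 1) = recurrencePoly β (n + 2)
          + C (β (n + 1)) * (recurrencePoly β 0 * recurrencePoly β n) := by
        simp [recurrencePoly]
      rw [h, map_add, hL, hC, h0, zero_add]
      by_cases hn : 0 = n
      · subst hn; simp [mul_comm]
      · simp [hn, Ne.symm hn]
  induction m using Nat.twoStepInduction generalizing n with
  | zero => exact h0 n
  | one => exact h1 n
  | more m ih ih' =>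
    cases n with
    | zero => rw [mul_comm, h0]; simp
    | succ n =>
      have h : recurrencePoly β (m + 2) * recurrencePoly β (n + 1) =
          recurrencePoly β (m + 1) * recurrencePoly β (n + 2)
          + C (β (n + 1)) * (recurrencePoly β (m + 1) * recurrencePoly β n)
          - C (β (m + 1)) * (recurrencePoly β m * recurrencePoly β (n + 1)) := by
        linear_combination recurrencePoly β (m + 1) * hmul n - recurrencePoly β (n + 1) * hmul m
      rw [h, map_sub, map_add, hC, hC, ih, ih', ih']
      rcases lt_trichotomy (m + 1) n with hmn | rfl | hmn
      · simp [show ¬ m + 1 = n by omega,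
          show ¬ m = n + 1 by omega, show ¬ m + 2 = n + 1 by omega]
      · simp [Finset.prod_range_succ, show ¬ m = m + 1 + 1 by omega]; ring
      · by_cases hmn' : m = n + 1
        · subst hmn'
          simp [Finset.prod_range_succ, show ¬ n + 1 + 1 = n by omega]; ring
        · simp [show ¬ m + 1 = n by omega,
            hmn', show ¬ m + 2 = n + 1 by omega]

/-- By the symmetry of the recurrence, the polynomials of even and odd index are `P (X ^ 2)` and
`X * Q (X ^ 2)` with monic `P` and `Q`. -/
theorem exists_recurrencePoly_eq_expand {R : Type*} [CommRing R] [Nontrivial R] (β : ℕ → R)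
    (l : ℕ) :
    (∃ P : R[X], P.Monic ∧ P.natDegree = l ∧ recurrencePoly β (2 * l) = expand R 2 P) ∧
    ∃ Q : R[X], Q.Monic ∧ Q.natDegree = l ∧
      recurrencePoly β (2 * l + 1) = X * expand R 2 Q := by
  have hsub {f g : R[X]} {d : ℕ} (c : R) (hf : f.Monic) (hfd : f.natDegree = d + 1)
      (hgd : g.natDegree ≤ d) :
      (f - C c * g).Monic ∧ (f - C c * g).natDegree = d + 1 := by
    have hlt : (C c * g).degree < f.degree := by
      rw [degree_eq_natDegree hf.ne_zero, hfd]
      refine degree_le_natDegree.trans_lt ?_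
      have := natDegree_C_mul_le c g
      exact_mod_cast (by omega : (C c * g).natDegree < d + 1)
    exact ⟨hf.sub_of_left hlt, by rw [natDegree_sub_eq_left_of_natDegree_lt, hfd]
                                  have := natDegree_C_mul_le c g; omega⟩
  induction l with
  | zero => exact ⟨⟨1, by simp [recurrencePoly]⟩, ⟨1, by simp [recurrencePoly]⟩⟩
  | succ l ih =>
    obtain ⟨⟨P, hP, hPd, hPe⟩, Q, hQ, hQd, hQe⟩ := ih
    have hP' := hsub (β (2 * l + 1)) (monic_X.mul hQ)
      (by rw [natDegree_X_mul hQ.ne_zero, hQd]) hPd.le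
    have hP'e : recurrencePoly β (2 * l + 2) =
        expand R 2 (X * Q - C (β (2 * l + 1)) * P) := by
      rw [recurrencePoly, hPe, hQe]; simp; ring
    refine ⟨⟨_, hP'.1, hP'.2, hP'e⟩,
      (X * Q - C (β (2 * l + 1)) * P) - C (β (2 * l + 2)) * Q, ?_⟩
    have hQ' := hsub (β (2 * l + 2)) hP'.1 hP'.2 hQd.le
    refine ⟨hQ'.1, hQ'.2, ?_⟩
    rw [show 2 * (l + 1) + 1 = (2 * l + 1) + 2 by ring, recurrencePoly, hP'e, hQe]
    simp; ring

/-- If `γ 0 = c` and successive ratios of `γ` are `δ 1, δ 2, …`, then `δ l` occurs in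
`γ l, …, γ n`, hence `n + 1 - l` times in their product. -/
theorem prod_range_eq_pow_mul_prod_pow {R : Type*} [CommRing R] (c : R) (γ δ : ℕ → R) (n : ℕ)
    (hγ : ∀ l, γ (l + 1) = γ l * δ (l + 1)) (h0 : γ 0 = c) :
    ∏ l ∈ Finset.range (n + 1), γ l =
      c ^ (n + 1) * ∏ l ∈ Finset.Icc 1 n, δ l ^ (n + 1 - l) := by
  have hγ' (n : ℕ) : γ n = c * ∏ l ∈ Finset.Icc 1 n, δ l := by
    induction n with
    | zero => simp [h0]
    | succ n ih => rw [hγ, ih, Finset.prod_Icc_succ_top (by omega), mul_assoc]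
  induction n with
  | zero => simp [h0]
  | succ n ih =>
    rw [Finset.prod_range_succ, ih, hγ' (n + 1), Finset.prod_Icc_succ_top (by omega),
      Finset.prod_Icc_succ_top (by omega)]
    have : ∏ l ∈ Finset.Icc 1 n, δ l ^ (n + 1 + 1 - l) =
        (∏ l ∈ Finset.Icc 1 n, δ l ^ (n + 1 - l)) * ∏ l ∈ Finset.Icc 1 n, δ l := by
      rw [← Finset.prod_mul_distrib]
      refine Finset.prod_congr rfl fun l hl => ?_
      rw [Finset.mem_Icc] at hl
      rw [show n + 1 + 1 - l = (n + 1 - l) + 1 by omega, pow_succ]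
    rw [this, show n + 1 + 1 - (n + 1) = 1 by omega]
    ring

/-- The Hankel determinants of the even moments, with and without the moment of order `0`, of a
functional whose orthogonal polynomials are the `recurrencePoly β`. -/
theorem hankelDet_even_moments {R : Type*} [CommRing R] [Nontrivial R] (β : ℕ → R)
    (L : R[X] →ₗ[R] R) (hL : ∀ n, L (recurrencePoly β (n + 1)) = 0) (n : ℕ) :
    hankelDet n (fun k => L (X ^ (2 * k))) =
      L 1 ^ (n + 1) *
        ∏ l ∈ Finset.Icc 1 n, (β (2 * l - 1) * β (2 * l)) ^ (n + 1 - l) ∧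
    hankelDet n (fun k => L (X ^ (2 * k + 2))) =
      (L 1 * β 1) ^ (n + 1) *
        ∏ l ∈ Finset.Icc 1 n, (β (2 * l) * β (2 * l + 1)) ^ (n + 1 - l) := by
  have horth := recurrencePoly_orthogonal β L hL
  choose hP hQ using exists_recurrencePoly_eq_expand β
  choose P hPm hPd hPe using hP
  choose Q hQm hQd hQe using hQ
  constructor
  · have h := hankelDet_eq_prod_of_orthogonal (L ∘ₗ (expand R 2).toLinearMap) P
      (fun l => L 1 * ∏ i ∈ Finset.range (2 * l), β (i + 1)) hPm hPd
      (fun i j => by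
        simp only [LinearMap.comp_apply, AlgHom.toLinearMap_apply, map_mul, ← hPe, horth]
        by_cases hij : i = j <;> simp [hij]) n
    simp only [LinearMap.comp_apply, AlgHom.toLinearMap_apply, map_pow, expand_X, ← pow_mul] at h
    rw [h]
    refine prod_range_eq_pow_mul_prod_pow _ _ (fun l => β (2 * l - 1) * β (2 * l)) n
      (fun l => ?_) (by simp)
    simp only [mul_add, mul_one, Finset.prod_range_succ]
    simp
    ring
  · have h := hankelDet_eq_prod_of_orthogonal
      (L ∘ₗ LinearMap.mulLeft R (X ^ 2) ∘ₗ (expand R 2).toLinearMap) Q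
      (fun l => L 1 * ∏ i ∈ Finset.range (2 * l + 1), β (i + 1)) hQm hQd
      (fun i j => by
        have hij : X ^ 2 * expand R 2 (Q i * Q j) =
            recurrencePoly β (2 * i + 1) * recurrencePoly β (2 * j + 1) := by
          rw [hQe, hQe, map_mul]; ring
        simp only [LinearMap.comp_apply, AlgHom.toLinearMap_apply, LinearMap.mulLeft_apply,
          hij, horth]
        by_cases hij : i = j <;> simp [hij]) n
    simp only [LinearMap.comp_apply, AlgHom.toLinearMap_apply, LinearMap.mulLeft_apply, map_pow,
      expand_X, ← pow_mul, ← pow_add] at h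
    simp only [add_comm _ 2]
    rw [h]
    refine prod_range_eq_pow_mul_prod_pow _ _ (fun l => β (2 * l) * β (2 * l + 1)) n
      (fun l => ?_) (by simp)
    simp only [mul_add, mul_one, Finset.prod_range_succ]
    ring

/-! ### The functional with moments given by Bernoulli polynomials -/

/-- The functional `f ↦ (F b - F a) / 2` on polynomials, where `F` is any polynomial with
`F (y + 1) - F y = f y`; on `X ^ m` such an `F` is `B_{m+1} / (m + 1)`. When `b - a` is a natural
number it is half of the sum of the values of `f` at `a, a + 1, …, b - 1`. -/
noncomputable def halfSum {K : Type*} [Field K] [CharZero K] (a b : K) : K[X] →ₗ[K] K :=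
  Polynomial.lsum fun m => LinearMap.mulRight K
    ((aeval b (Polynomial.bernoulli (m + 1)) - aeval a (Polynomial.bernoulli (m + 1))) /
      (2 * ((m : K) + 1)))

theorem halfSum_X_pow {K : Type*} [Field K] [CharZero K] (a b : K) (m : ℕ) :
    halfSum a b (X ^ m) =
      (aeval b (Polynomial.bernoulli (m + 1)) - aeval a (Polynomial.bernoulli (m + 1))) /
        (2 * ((m : K) + 1)) := by
  rw [halfSum, lsum_apply, ← monomial_one_right_eq_X_pow, sum_monomial_index _ _ (by simp)]
  simp

/-- The functional inverts the forward difference. On monomials this is the identity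
`∑ k ∈ range (m + 1), (m + 1).choose k • B_k = (m + 1) X ^ m`. -/
theorem halfSum_difference {K : Type*} [Field K] [CharZero K] (a b : K) (F : K[X]) :
    halfSum a b (F.comp (X + 1) - F) = (F.eval b - F.eval a) / 2 := by
  induction F using Polynomial.induction_on' with
  | add p q hp hq =>
    rw [add_comp, add_sub_add_comm, map_add, hp, hq, eval_add, eval_add]; ring
  | monomial m c =>
    have hsum (t : K) : ∑ i ∈ Finset.range m, ((m + 1).choose (i + 1) : K) *
        aeval t (Polynomial.bernoulli (i + 1)) = (m + 1) * t ^ m - 1 := by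
      have h := congrArg (aeval t) (Polynomial.sum_bernoulli m)
      rw [map_sum, Finset.sum_range_succ'] at h
      simp [aeval_monomial] at h
      rw [add_one_mul, ← h]
      simp [Algebra.smul_def]
    have hpow : ((X : K[X]) + 1) ^ m - X ^ m =
        ∑ i ∈ Finset.range m, (m.choose i : K) • X ^ i := by
      rw [add_pow, Finset.sum_range_succ]
      simp [smul_eq_C_mul, mul_comm]
    have hm : (m : K) + 1 ≠ 0 := by exact_mod_cast m.succ_ne_zero
    have hmain : halfSum a b (((X : K[X]) + 1) ^ m - X ^ m) = (b ^ m - a ^ m) / 2 := by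
      have hterm (i : ℕ) : (m.choose i : K) * ((aeval b (Polynomial.bernoulli (i + 1)) -
          aeval a (Polynomial.bernoulli (i + 1))) / (2 * ((i : K) + 1))) =
          (((m + 1).choose (i + 1) : K) * aeval b (Polynomial.bernoulli (i + 1)) -
            ((m + 1).choose (i + 1) : K) * aeval a (Polynomial.bernoulli (i + 1))) /
            (2 * ((m : K) + 1)) := by
        have hi : (i : K) + 1 ≠ 0 := by exact_mod_cast i.succ_ne_zero
        have h : ((m : K) + 1) * m.choose i = (m + 1).choose (i + 1) * (i + 1) := by
          exact_mod_cast Nat.add_one_mul_choose_eq m i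
        field_simp
        linear_combination (aeval b (Polynomial.bernoulli (i + 1)) -
          aeval a (Polynomial.bernoulli (i + 1))) * h
      rw [hpow, map_sum]
      simp only [map_smul, halfSum_X_pow, smul_eq_mul, hterm]
      rw [← Finset.sum_div, Finset.sum_sub_distrib, hsum, hsum]
      field_simp
      ring
    rw [← C_mul_X_pow_eq_monomial, mul_comp, C_comp, X_pow_comp, ← mul_sub, ← smul_eq_C_mul,
      map_smul, hmain]
    simp
    ring

theorem halfSum_descPochhammer {K : Type*} [Field K] [CharZero K] (a b : K) (k : ℕ) :
    halfSum a b ((descPochhammer K k).comp (X - C a)) =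
      (descPochhammer K (k + 1)).eval (b - a) / (2 * (k + 1)) := by
  have hk : (k : K) + 1 ≠ 0 := by exact_mod_cast k.succ_ne_zero
  have hdiff : ((descPochhammer K (k + 1)).comp (X - C a)).comp (X + 1) -
      (descPochhammer K (k + 1)).comp (X - C a) =
      ((k : K) + 1) • (descPochhammer K k).comp (X - C a) := by
    have h := congrArg (fun p => p.comp (X - C a + 1)) 
      (descPochhammer_succ_comp_X_sub_one (R := K) k)
    simp only [sub_comp, comp_assoc, X_comp, one_comp, add_sub_cancel_right, smul_eq_mul,
      mul_comp, add_comp, natCast_comp] at h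
    rw [comp_assoc, sub_comp, X_comp, C_comp, show (X : K[X]) + 1 - C a = X - C a + 1 by ring, h]
    simp [smul_eq_C_mul]
  have h := halfSum_difference a b ((descPochhammer K (k + 1)).comp (X - C a))
  rw [hdiff, map_smul, smul_eq_mul] at h
  have h0 : (descPochhammer K (k + 1)).eval 0 = 0 :=
    descPochhammer_ne_zero_eval_zero K (Nat.succ_ne_zero k)
  simp only [eval_comp, eval_sub, eval_X, eval_C, sub_self, h0, sub_zero] at h
  rw [eq_div_iff (mul_ne_zero two_ne_zero hk)]
  linear_combination 2 * h

theorem aeval_bernoulli_one_sub {K : Type*} [Field K] [CharZero K] (n : ℕ) (t : K) :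
    aeval (1 - t) (Polynomial.bernoulli n) = (-1) ^ n * aeval t (Polynomial.bernoulli n) := by
  have h := congrArg (aeval t) (Polynomial.bernoulli_comp_one_sub_X n)
  simpa [aeval_comp] using h

/-- The end points `(1 - x) / 2` and `(x + 1) / 2` are symmetric about `1 / 2`, and
`B_{2k+1}` is odd about that point, so both contribute equally. -/
theorem halfSum_symm_X_pow {K : Type*} [Field K] [CharZero K] (x : K) (k : ℕ) :
    halfSum ((1 - x) / 2) ((x + 1) / 2) (X ^ (2 * k)) =
      aeval ((x + 1) / 2) (Polynomial.bernoulli (2 * k + 1)) / (2 * (k : K) + 1) := by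
  have hk : 2 * (k : K) + 1 ≠ 0 := by exact_mod_cast (2 * k).succ_ne_zero
  rw [halfSum_X_pow, show (1 - x) / 2 = 1 - (x + 1) / 2 by ring, aeval_bernoulli_one_sub,
    Odd.neg_one_pow ⟨k, rfl⟩]
  push_cast
  field_simp
  ring

/-! ### Discrete Chebyshev polynomials -/

/-- The coefficient of the discrete Chebyshev polynomial of degree `n` at the falling factorial
of degree `k`, with value `0` for `k > n`. -/
noncomputable def chebCoeff {K : Type*} [Field K] (x : K) (n k : ℕ) : K :=
  (-1) ^ (n + k) * n.choose k * (n + k).choose k * (descPochhammer K (n - k)).eval (x - 1 - k)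

theorem chebCoeff_of_lt {K : Type*} [Field K] (x : K) {n k : ℕ} (h : n < k) :
    chebCoeff x n k = 0 := by
  simp [chebCoeff, Nat.choose_eq_zero_of_lt h]

theorem chebCoeff_add {K : Type*} [Field K] [CharZero K] (x : K) (k j : ℕ) :
    chebCoeff x (k + j) k = (-1) ^ j * (((2 * k + j).factorial : K) /
      ((k.factorial : K) ^ 2 * j.factorial)) * (descPochhammer K j).eval (x - 1 - k) := by
  have h1 : ((k + j).factorial : K) ≠ 0 := by exact_mod_cast (k + j).factorial_ne_zero
  have h2 : (k.factorial : K) ≠ 0 := by exact_mod_cast k.factorial_ne_zero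
  have h3 : (j.factorial : K) ≠ 0 := by exact_mod_cast j.factorial_ne_zero
  have hsign : (-1 : K) ^ (k + j + k) = (-1) ^ j := by
    rw [show k + j + k = j + 2 * k by ring, pow_add, pow_mul]; simp
  rw [chebCoeff, hsign, Nat.cast_add_choose, add_comm (k + j) k, Nat.cast_add_choose,
    Nat.add_sub_cancel_left, show k + (k + j) = 2 * k + j by ring]
  field_simp

theorem descPochhammer_succ_eval_left {R : Type*} [CommRing R] (n : ℕ) (t : R) :
    (descPochhammer R (n + 1)).eval t = t * (descPochhammer R n).eval (t - 1) := by
  simp [descPochhammer_succ_left]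

/-- The coefficient at `k = 0` of the three-term recurrence `chebPoly_recurrence`. -/
theorem chebCoeff_recurrence_zero {K : Type*} [Field K] [CharZero K] (x : K) (n : ℕ) :
    ((n : K) + 2) * chebCoeff x (n + 2) 0 =
      (2 * n + 3) * ((1 - x) * chebCoeff x (n + 1) 0) -
        (n + 1) * (x ^ 2 - (n + 1) ^ 2) * chebCoeff x n 0 := by
  simp only [chebCoeff, Nat.sub_zero, descPochhammer_succ_eval, Nat.choose_zero_right]
  push_cast
  ring

/-- The coefficient at `k + 1` of the three-term recurrence `chebPoly_recurrence`. For `k < n`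
all four terms are multiples of the falling factorial of `x - 2 - k` that occurs in
`chebCoeff x n (k + 1)`; for `n ≤ k` that coefficient vanishes. -/
theorem chebCoeff_recurrence_succ {K : Type*} [Field K] [CharZero K] (x : K) (n k : ℕ) :
    ((n : K) + 2) * chebCoeff x (n + 2) (k + 1) =
      (2 * n + 3) * (2 * chebCoeff x (n + 1) k +
        (2 * (k + 1) + 1 - x) * chebCoeff x (n + 1) (k + 1)) -
        (n + 1) * (x ^ 2 - (n + 1) ^ 2) * chebCoeff x n (k + 1) := by
  have h2 : (k.factorial : K) ≠ 0 := by exact_mod_cast k.factorial_ne_zero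
  have h4 : (k : K) + 1 ≠ 0 := by exact_mod_cast k.succ_ne_zero
  rcases lt_trichotomy n k with h | rfl | h
  · rw [chebCoeff_of_lt x (by omega : n < k + 1), chebCoeff_of_lt x (by omega : n + 1 < k + 1)]
    rcases Nat.lt_or_ge (n + 1) k with h' | h'
    · rw [chebCoeff_of_lt x (by omega : n + 2 < k + 1), chebCoeff_of_lt x h']
      ring
    · obtain rfl : k = n + 1 := by omega
      have e1 := chebCoeff_add x (n + 2) 0
      have e2 := chebCoeff_add x (n + 1) 0
      simp only [add_zero, show 2 * (n + 2) = 2 * (n + 1) + 1 + 1 by ring] at e1 e2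
      rw [show n + 1 + 1 = n + 2 by ring, e1, e2]
      simp only [Nat.factorial_succ (n + 1), Nat.factorial_succ (2 * (n + 1) + 1),
        Nat.factorial_succ (2 * (n + 1))]
      have h5 : (n : K) + 1 + 1 ≠ 0 := by exact_mod_cast (n + 1).succ_ne_zero
      push_cast
      simp only [descPochhammer_zero, eval_one, Nat.factorial_zero, Nat.cast_one]
      field_simp
      ring
  · have e1 := chebCoeff_add x (n + 1) 1
    have e2 := chebCoeff_add x n 1
    have e3 := chebCoeff_add x (n + 1) 0
    simp only [add_zero, show n + 1 + 1 = n + 2 by ring, show 2 * (n + 1) = 2 * n + 1 + 1 by ring]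
      at e1 e2 e3
    rw [chebCoeff_of_lt x (by omega : n < n + 1), e1, e2, e3]
    simp only [Nat.factorial_succ n, Nat.factorial_succ (2 * n + 1 + 1),
      Nat.factorial_succ (2 * n + 1)]
    push_cast
    simp only [descPochhammer_zero, descPochhammer_one, eval_X, eval_one, Nat.factorial_zero,
      Nat.factorial_one, Nat.cast_one]
    field_simp
    ring
  · obtain ⟨j, rfl⟩ := Nat.exists_eq_add_of_lt h
    have h3 : (j.factorial : K) ≠ 0 := by exact_mod_cast j.factorial_ne_zero
    have h5 : (j : K) + 1 ≠ 0 := by exact_mod_cast j.succ_ne_zero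
    have h6 : (j : K) + 1 + 1 ≠ 0 := by exact_mod_cast (j + 1).succ_ne_zero
    have e1 := chebCoeff_add x (k + 1) (j + 2)
    have e2 := chebCoeff_add x k (j + 2)
    have e3 := chebCoeff_add x (k + 1) (j + 1)
    have e4 := chebCoeff_add x (k + 1) j
    rw [show k + 1 + (j + 2) = k + j + 1 + 2 by ring] at e1
    rw [show k + (j + 2) = k + j + 1 + 1 by ring] at e2
    rw [show k + 1 + (j + 1) = k + j + 1 + 1 by ring] at e3
    rw [show k + 1 + j = k + j + 1 by ring] at e4
    -- Only `chebCoeff x (k + j + 2) k` extends the common falling factorial at its start, by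
    -- the factor `x - 1 - k`; all other extensions are at its end.
    rw [e1, e2, e3, e4, descPochhammer_succ_eval_left (j + 1) (x - 1 - k),
      show x - 1 - (k : K) - 1 = x - 1 - ((k + 1 : ℕ) : K) by push_cast; ring]
    simp only [descPochhammer_succ_eval,
      show 2 * (k + 1) + (j + 2) = 2 * k + j + 2 + 1 + 1 by ring,
      show 2 * (k + 1) + (j + 1) = 2 * k + j + 2 + 1 by ring,
      show 2 * (k + 1) + j = 2 * k + j + 2 by ring,
      show 2 * k + (j + 2) = 2 * k + j + 2 by ring,
      Nat.factorial_succ k, Nat.factorial_succ j, Nat.factorial_succ (j + 1),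
      Nat.factorial_succ (2 * k + j + 2), Nat.factorial_succ (2 * k + j + 2 + 1)]
    generalize (descPochhammer K j).eval (x - 1 - ((k + 1 : ℕ) : K)) = P
    push_cast
    field_simp
    ring

/-- The discrete Chebyshev polynomial of degree `n` for the nodes `a, a + 1, …, a + x - 1`
centred at the origin, that is `a = (1 - x) / 2`, with leading coefficient `(2 n).choose n`.
Here `x` is any element of the field. -/
noncomputable def chebPoly {K : Type*} [Field K] (x : K) (n : ℕ) : K[X] :=
  ∑ k ∈ Finset.range (n + 1),
    chebCoeff x n k • (descPochhammer K k).comp (X - C ((1 - x) / 2))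

theorem chebPoly_eq_sum {K : Type*} [Field K] (x : K) {n N : ℕ} (h : n < N) :
    chebPoly x n = ∑ k ∈ Finset.range N,
      chebCoeff x n k • (descPochhammer K k).comp (X - C ((1 - x) / 2)) := by
  refine Finset.sum_subset (Finset.range_subset_range.2 h) fun k _ hk => ?_
  rw [chebCoeff_of_lt x (by simpa using hk), zero_smul]

theorem chebPoly_recurrence {K : Type*} [Field K] [CharZero K] (x : K) (n : ℕ) :
    ((n : K) + 2) • chebPoly x (n + 2) =
      (2 * (2 * (n : K) + 3)) • (X * chebPoly x (n + 1)) -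
        (((n : K) + 1) * (x ^ 2 - (n + 1) ^ 2)) • chebPoly x n := by
  set e : ℕ → K[X] := fun k => (descPochhammer K k).comp (X - C ((1 - x) / 2)) with he
  -- Multiplication by `2 X` in the basis `e`, since `2 X = 2 (X - a - k) + (2 k + 1 - x)`.
  have hX (k : ℕ) : (2 : K) • (X * e k) = (2 : K) • e (k + 1) + (2 * (k : K) + 1 - x) • e k := by
    have hsucc : e (k + 1) = e k * (X - C ((1 - x) / 2) - C (k : K)) := by
      simp [he, descPochhammer_succ_right, mul_comp]
    have hC : (2 : K[X]) * C ((1 - x) / 2) = 1 - C x := by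
      rw [← map_ofNat C 2, ← C_mul, mul_div_cancel₀ _ two_ne_zero]; simp
    rw [hsucc]
    simp only [smul_eq_C_mul, C_add, C_sub, C_mul, C_1, map_ofNat]
    linear_combination e k * hC
  have hmid : (2 : K) • (X * chebPoly x (n + 1)) =
      ∑ k ∈ Finset.range (n + 2), (2 * chebCoeff x (n + 1) k) • e (k + 1) +
      ∑ k ∈ Finset.range (n + 3), ((2 * (k : K) + 1 - x) * chebCoeff x (n + 1) k) • e k := by
    rw [Finset.sum_range_succ _ (n + 2), chebCoeff_of_lt x (by omega : n + 1 < n + 2), mul_zero,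
      zero_smul, add_zero, ← Finset.sum_add_distrib, chebPoly, Finset.mul_sum, Finset.smul_sum]
    refine Finset.sum_congr rfl fun k _ => ?_
    rw [mul_smul_comm, smul_comm, hX, smul_add, smul_smul, smul_smul, mul_comm, mul_comm (_ - x)]
  rw [mul_comm (2 : K) (2 * n + 3), mul_smul (2 * (n : K) + 3), hmid,
    chebPoly_eq_sum x (by omega : n < n + 3), chebPoly,
    Finset.sum_range_succ' _ (n + 2), Finset.sum_range_succ' _ (n + 2),
    Finset.sum_range_succ' _ (n + 2)]
  have h0 := chebCoeff_recurrence_zero x n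
  simp only [smul_add, Finset.smul_sum, smul_smul]
  have hs : ∑ k ∈ Finset.range (n + 2), (((n : K) + 2) * chebCoeff x (n + 2) (k + 1)) • e (k + 1) =
      ∑ k ∈ Finset.range (n + 2), ((2 * (n : K) + 3) * (2 * chebCoeff x (n + 1) k)) • e (k + 1) +
      ∑ k ∈ Finset.range (n + 2), ((2 * (n : K) + 3) * ((2 * ((k + 1 : ℕ) : K) + 1 - x) *
        chebCoeff x (n + 1) (k + 1))) • e (k + 1) -
      ∑ k ∈ Finset.range (n + 2), ((n + 1) * (x ^ 2 - (n + 1) ^ 2) *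
        chebCoeff x n (k + 1)) • e (k + 1) := by
    rw [← Finset.sum_add_distrib, ← Finset.sum_sub_distrib]
    refine Finset.sum_congr rfl fun k _ => ?_
    rw [← add_smul, ← sub_smul, chebCoeff_recurrence_succ]
    push_cast
    congr 1
    ring
  have hz : (((n : K) + 2) * chebCoeff x (n + 2) 0) • e 0 =
      ((2 * (n : K) + 3) * ((2 * ((0 : ℕ) : K) + 1 - x) * chebCoeff x (n + 1) 0)) • e 0 -
      ((n + 1) * (x ^ 2 - (n + 1) ^ 2) * chebCoeff x n 0) • e 0 := by
    rw [← sub_smul, h0]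
    push_cast
    congr 1
    ring
  simp only [he] at hs hz ⊢
  rw [hs, hz]
  abel

/-- The coefficient `β n` of the three-term recurrence of the monic discrete Chebyshev
polynomials. -/
noncomputable def chebBeta {K : Type*} [Field K] (x : K) (n : ℕ) : K :=
  (n : K) ^ 2 * (x ^ 2 - n ^ 2) / (4 * (2 * n - 1) * (2 * n + 1))

/-- The explicit polynomials `chebPoly x n` are the multiples by the leading coefficient
`(2 n).choose n` of the monic polynomials defined by the recurrence. -/
theorem centralBinom_smul_recurrencePoly {K : Type*} [Field K] [CharZero K] (x : K) (n : ℕ) :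
    (n.centralBinom : K) • recurrencePoly (chebBeta x) n = chebPoly x n := by
  have hcb (n : ℕ) : ((n : K) + 1) * (n + 1).centralBinom =
      2 * (2 * n + 1) * n.centralBinom := by
    exact_mod_cast Nat.succ_mul_centralBinom_succ n
  induction n using Nat.twoStepInduction with
  | zero => simp [recurrencePoly, chebPoly, chebCoeff]
  | one =>
    have hC : (2 : K[X]) * C ((1 - x) / 2) = 1 - C x := by
      rw [← map_ofNat C 2, ← C_mul, mul_div_cancel₀ _ two_ne_zero]; simp
    simp [recurrencePoly, chebPoly, chebCoeff, Finset.sum_range_succ, smul_eq_C_mul,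
      Nat.centralBinom]
    rw [map_ofNat]
    linear_combination hC
  | more n ih ih' =>
    have h2 : (n : K) + 2 ≠ 0 := by exact_mod_cast (n + 1).succ_ne_zero
    have h1 : (n : K) + 1 ≠ 0 := by exact_mod_cast n.succ_ne_zero
    have h3 : 2 * (n : K) + 1 ≠ 0 := by exact_mod_cast (2 * n).succ_ne_zero
    have h5 : 2 * (n : K) + 3 ≠ 0 := by exact_mod_cast (2 * n + 2).succ_ne_zero
    have hc1 := hcb n
    have hc2 := hcb (n + 1)
    have hβ : ((n : K) + 2) * (n + 2).centralBinom * chebBeta x (n + 1) =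
        (n + 1) * (x ^ 2 - (n + 1) ^ 2) * n.centralBinom := by
      have hb : chebBeta x (n + 1) =
          ((n : K) + 1) ^ 2 * (x ^ 2 - (n + 1) ^ 2) / (4 * (2 * n + 1) * (2 * n + 3)) := by
        rw [chebBeta]; push_cast; congr 1; ring
      push_cast at hc2
      rw [hb, mul_div_assoc', div_eq_iff
        (mul_ne_zero (mul_ne_zero (by norm_num) h3) h5)]
      linear_combination (n + 1) * (x ^ 2 - (n + 1) ^ 2) *
        ((n + 1) * hc2 + 2 * (2 * n + 3) * hc1)
    apply smul_right_injective _ h2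
    simp only
    rw [chebPoly_recurrence, ← ih, ← ih', recurrencePoly]
    push_cast at hc2
    simp only [smul_sub, smul_smul, mul_smul_comm, ← smul_eq_C_mul]
    rw [← mul_assoc ((n : K) + 2), hβ, show ((n : K) + 2) * (n + 1 + 1).centralBinom =
      2 * (2 * n + 3) * (n + 1).centralBinom by linear_combination hc2]

/-- The partial sums have the closed form
`∑ k < m, (-1)^k C(n,k) C(n+k,k) / (k+1) = -(-1)^m C(n,m) C(n+m,m) m / (n (n+1))`,
which vanishes at `m = n + 1`. -/
theorem sum_neg_one_pow_choose_mul_choose_div {K : Type*} [Field K] [CharZero K] {n : ℕ}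
    (hn : n ≠ 0) :
    ∑ k ∈ Finset.range (n + 1),
      (-1 : K) ^ k * n.choose k * (n + k).choose k / (k + 1) = 0 := by
  have hn0 : (n : K) ≠ 0 := by exact_mod_cast hn
  have hn1 : (n : K) + 1 ≠ 0 := by exact_mod_cast n.succ_ne_zero
  have hpartial (m : ℕ) : ∑ k ∈ Finset.range m,
      (-1 : K) ^ k * n.choose k * (n + k).choose k / (k + 1) =
      -((-1) ^ m * n.choose m * (n + m).choose m * m / (n * (n + 1))) := by
    induction m with
    | zero => simp
    | succ m ih =>
      have hm : (m : K) + 1 ≠ 0 := by exact_mod_cast m.succ_ne_zero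
      have h1 : (n.choose (m + 1) : K) * (m + 1) = n.choose m * (n - m) := by
        rcases le_or_gt m n with h | h
        · rw [← Nat.cast_sub h]
          exact_mod_cast Nat.choose_succ_right_eq n m
        · simp [Nat.choose_eq_zero_of_lt h, Nat.choose_eq_zero_of_lt (h.trans m.lt_succ_self)]
      have h2 : ((n + (m + 1)).choose (m + 1) : K) * (m + 1) =
          (n + m).choose m * (n + m + 1) := by
        have := Nat.add_one_mul_choose_eq (n + m) m
        rw [← add_assoc]
        have h : ((n + m + 1 : ℕ) : K) * (n + m).choose m =
          (n + m + 1).choose (m + 1) * ((m + 1 : ℕ) : K) := by exact_mod_cast this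
        push_cast at h
        linear_combination -h
      rw [Finset.sum_range_succ, ih, eq_div_of_mul_eq hm h1, eq_div_of_mul_eq hm h2]
      push_cast
      field_simp
      ring
  rw [hpartial]
  simp

/-- On the term of `chebPoly x n` with index `k` the two falling factorials combine to
`x (x - 1) ⋯ (x - n)`, independent of `k`; what is left is the sum
`sum_neg_one_pow_choose_mul_choose_div`. -/
theorem halfSum_recurrencePoly_chebBeta {K : Type*} [Field K] [CharZero K] (x : K) (n : ℕ) :
    halfSum ((1 - x) / 2) ((x + 1) / 2) (recurrencePoly (chebBeta x) (n + 1)) = 0 := by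
  have hcb : ((n + 1).centralBinom : K) ≠ 0 := by
    exact_mod_cast (n + 1).centralBinom_ne_zero
  suffices h : halfSum ((1 - x) / 2) ((x + 1) / 2) (chebPoly x (n + 1)) = 0 by
    rw [← centralBinom_smul_recurrencePoly, map_smul, smul_eq_mul] at h
    exact (mul_eq_zero.1 h).resolve_left hcb
  have hterm : ∀ k ∈ Finset.range (n + 1 + 1), chebCoeff x (n + 1) k *
      ((descPochhammer K (k + 1)).eval ((x + 1) / 2 - (1 - x) / 2) / (2 * (k + 1))) =
      ((-1) ^ (n + 1) * (descPochhammer K (n + 2)).eval x / 2) *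
        ((-1 : K) ^ k * (n + 1).choose k * (n + 1 + k).choose k / (k + 1)) := by
    intro k hk
    have hk' : k + 1 + (n + 1 - k) = n + 2 := by
      rw [Finset.mem_range] at hk; omega
    have hk1 : (k : K) + 1 ≠ 0 := by exact_mod_cast k.succ_ne_zero
    have h := congrArg (eval x) (descPochhammer_mul (R := K) (k + 1) (n + 1 - k))
    rw [hk'] at h
    simp only [eval_mul, eval_comp, eval_sub, eval_X, eval_natCast] at h
    rw [← h, chebCoeff, show (x + 1) / 2 - (1 - x) / 2 = x by ring, pow_add,
      show x - ((k + 1 : ℕ) : K) = x - 1 - k by push_cast; ring]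
    field_simp
  rw [chebPoly, map_sum]
  simp only [map_smul, halfSum_descPochhammer, smul_eq_mul]
  rw [Finset.sum_congr rfl hterm, ← Finset.mul_sum,
    sum_neg_one_pow_choose_mul_choose_div n.succ_ne_zero, mul_zero]

/-! ### The two evaluations -/

theorem proposition1p4 {K : Type*} [Field K] [CharZero K] (x : K) (n : ℕ) :
    hankelDet n (fun k : ℕ =>
        aeval ((x + 1) / 2) (Polynomial.bernoulli (2 * k + 1)) / (2 * (k : K) + 1)) =
      (x / 2) ^ (n + 1) *
        ∏ l ∈ Finset.Icc 1 n,
          (((2 * (l : K)) ^ 2 * (2 * (l : K) - 1) ^ 2 *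
              (x ^ 2 - (2 * (l : K) - 1) ^ 2) * (x ^ 2 - (2 * (l : K)) ^ 2)) /
            (16 * (4 * (l : K) - 3) * (4 * (l : K) - 1) ^ 2 * (4 * (l : K) + 1))) ^ (n + 1 - l) ∧
    hankelDet n (fun k : ℕ =>
        aeval ((x + 1) / 2) (Polynomial.bernoulli (2 * k + 3)) / (2 * (k : K) + 3)) =
      ((x ^ 3 - x) / 24) ^ (n + 1) *
        ∏ l ∈ Finset.Icc 1 n,
          (((2 * (l : K)) ^ 2 * (2 * (l : K) + 1) ^ 2 *
              (x ^ 2 - (2 * (l : K) + 1) ^ 2) * (x ^ 2 - (2 * (l : K)) ^ 2)) /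
            (16 * (4 * (l : K) - 1) * (4 * (l : K) + 1) ^ 2 * (4 * (l : K) + 3))) ^ (n + 1 - l) := by
  obtain ⟨h1, h2⟩ := hankelDet_even_moments (chebBeta x)
    (halfSum ((1 - x) / 2) ((x + 1) / 2)) (halfSum_recurrencePoly_chebBeta x) n
  have hL1 : halfSum ((1 - x) / 2) ((x + 1) / 2) (1 : K[X]) = x / 2 := by
    have h := halfSum_symm_X_pow x 0
    simp at h
    rw [h]
    ring
  have hshift (k : ℕ) : halfSum ((1 - x) / 2) ((x + 1) / 2) (X ^ (2 * k + 2)) =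
      aeval ((x + 1) / 2) (Polynomial.bernoulli (2 * k + 3)) / (2 * (k : K) + 3) := by
    rw [show 2 * k + 2 = 2 * (k + 1) by ring, halfSum_symm_X_pow]
    push_cast
    congr 1
    ring
  simp only [halfSum_symm_X_pow, hshift, hL1] at h1 h2
  constructor
  · rw [h1]
    congr 1
    refine Finset.prod_congr rfl fun l hl => ?_
    have hl : 1 ≤ l := (Finset.mem_Icc.1 hl).1
    rw [chebBeta, chebBeta, div_mul_div_comm]
    push_cast [show 1 ≤ 2 * l by omega]
    congr 2 <;> ring
  · rw [h2]
    congr 1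
    · congr 1
      simp [chebBeta]
      ring
    · refine Finset.prod_congr rfl fun l _ => ?_
      rw [chebBeta, chebBeta, div_mul_div_comm]
      push_cast
      congr 2 <;> ring
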